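/- Let $K$ be a field, let $\alpha\in K$ with $\alpha\neq 0$, and let $RR_2$ be the three-dimensional $K$-algebra with basis $e_1,e_2,e_3$ and multiplication $e_1e_3=\alpha e_1$, $e_3e_2=e_2$, $e_2e_3=-e_2$, all other products of basis vectors being $0$. It is a (right) Leibniz algebra, i.e. $x(yz)=(xy)z-(xz)y$ for all $x,y,z$. Let $\mathcal L\langle X\rangle$ be the free Leibniz algebra over $K$ freely generated by a countably infinite set of variables $X$ containing distinct variables $x_1,x_2,x_3,x_4$. A T-ideal is a two-sided ideal of $\mathcal L\langle X\rangle$ invariant under all endomorphisms. Let $T(RR_2)$ be the T-ideal of polynomial identities of $RR_2$, i.e. of all $f\in\mathcal L\langle X\rangle$ that vanish under every evaluation of the variables in $RR_2$. A set $S$ is called a basis of a T-ideal if that T-ideal is the smallest T-ideal containing $S$. Products written without parentheses are left-normed, $ab^{(n)}=(\cdots((ab)b)\cdots)b$ with $n$ factors $b$, and $x^{n}=x^{(n)}=(\cdots((xx)x)\cdots)x$ is the left-normed product of $n\ge 1$ factors $x$. Put $$s_3(x_1,x_2,x_3)=x_1x_2x_3-x_1x_3x_2-x_2x_1x_3+x_2x_3x_1+x_3x_1x_2-x_3x_2x_1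 .$$ (a) If $K$ is finite with $|K|=q$, then the six polynomials $$(x_1x_2)(x_3x_4),\qquad s_3(x_1,x_2,x_3),\qquad x_1^{q+1}-x_1^2,$$ $$x_1x_2^{(2)}x_3-x_3x_2^{(2)}x_1x_3^{(q-1)}+x_3^{(q)}x_2^{(2)}x_1-x_1x_3^{(q)}x_2^{(2)},$$ $$x_1x_2^{(2)}x_3x_1^{(q-1)}-x_1x_2^{(2)}x_3-x_1x_3^{(q)}x_2^{(2)}x_1^{(q-1)}+x_1x_3^{(q)}x_2^{(2)},$$ $$x_1x_2^{(q)}x_1^{(q-1)}-x_1x_2x_1^{(q-1)}-x_1x_2^{(q)}+x_1x_2$$ form a basis of the T-ideal $T(RR_2)$. (b) If $K$ is infinite, then $(x_1x_2)(x_3x_4)$ and $s_3(x_1,x_2,x_3)$ form a basis of the T-ideal $T(RR_2)$. -/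

import Mathlib

/-- A (right) Leibniz algebra: a nonassociative `K`-algebra (this is expressed by the ambient
classes) in which `x(yz) = (xy)z - (xz)y` holds. -/
class IsLeibniz (A : Type*) [NonUnitalNonAssocRing A] : Prop where
  leibniz : ∀ x y z : A, x * (y * z) = (x * y) * z - (x * z) * y

section FreeLeibniz

variable (K : Type*) [Field K] (X : Type*)

/-- The congruence on the free nonassociative algebra generated by the Leibniz identity. -/
inductive FreeLeibniz.Rel :
    FreeNonUnitalNonAssocAlgebra K X → FreeNonUnitalNonAssocAlgebra K X → Prop
  | leibniz (a b c : FreeNonUnitalNonAssocAlgebra K X) :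
      FreeLeibniz.Rel (a * (b * c)) ((a * b) * c - (a * c) * b)
  | smul (t : K) {a b : FreeNonUnitalNonAssocAlgebra K X} :
      FreeLeibniz.Rel a b → FreeLeibniz.Rel (t • a) (t • b)
  | add_right {a b : FreeNonUnitalNonAssocAlgebra K X} (c : FreeNonUnitalNonAssocAlgebra K X) :
      FreeLeibniz.Rel a b → FreeLeibniz.Rel (a + c) (b + c)
  | mul_left (a : FreeNonUnitalNonAssocAlgebra K X) {b c : FreeNonUnitalNonAssocAlgebra K X} :
      FreeLeibniz.Rel b c → FreeLeibniz.Rel (a * b) (a * c)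
  | mul_right {a b : FreeNonUnitalNonAssocAlgebra K X} (c : FreeNonUnitalNonAssocAlgebra K X) :
      FreeLeibniz.Rel a b → FreeLeibniz.Rel (a * c) (b * c)

/-- The free Leibniz algebra over `K` freely generated by `X`: the quotient of the free
nonassociative algebra by the smallest congruence forcing the Leibniz identity. -/
def FreeLeibniz := Quot (FreeLeibniz.Rel K X)

end FreeLeibniz

namespace FreeLeibniz

variable {K : Type*} [Field K] {X : Type*}

theorem Rel.addLeft (a : FreeNonUnitalNonAssocAlgebra K X)
    {b c : FreeNonUnitalNonAssocAlgebra K X} (h : Rel K X b c) : Rel K X (a + b) (a + c) := by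
  rw [add_comm _ b, add_comm _ c]; exact h.add_right _

theorem Rel.neg {a b : FreeNonUnitalNonAssocAlgebra K X} (h : Rel K X a b) :
    Rel K X (-a) (-b) := by
  simpa only [neg_one_smul] using h.smul (-1)

theorem Rel.subLeft (a : FreeNonUnitalNonAssocAlgebra K X)
    {b c : FreeNonUnitalNonAssocAlgebra K X} (h : Rel K X b c) : Rel K X (a - b) (a - c) := by
  simpa only [sub_eq_add_neg] using h.neg.addLeft a

theorem Rel.subRight {a b : FreeNonUnitalNonAssocAlgebra K X}
    (c : FreeNonUnitalNonAssocAlgebra K X) (h : Rel K X a b) : Rel K X (a - c) (b - c) := by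
  simpa only [sub_eq_add_neg] using h.add_right (-c)

noncomputable instance : SMul K (FreeLeibniz K X) where
  smul t := Quot.map (t • ·) fun _ _ h => h.smul t

noncomputable instance : SMul ℕ (FreeLeibniz K X) where
  smul n := Quot.map (n • ·) fun a b h => by
    simpa only [Nat.cast_smul_eq_nsmul] using h.smul (n : K)

noncomputable instance : SMul ℤ (FreeLeibniz K X) where
  smul n := Quot.map (n • ·) fun a b h => by
    simpa only [Int.cast_smul_eq_zsmul] using h.smul (n : K)

noncomputable instance : Zero (FreeLeibniz K X) where zero := Quot.mk _ 0

noncomputable instance : Add (FreeLeibniz K X) where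
  add := Quot.map₂ (· + ·) (fun _ _ _ => Rel.addLeft _) fun _ _ _ => Rel.add_right _

noncomputable instance : Neg (FreeLeibniz K X) where neg := Quot.map Neg.neg fun _ _ => Rel.neg

noncomputable instance : Sub (FreeLeibniz K X) where
  sub := Quot.map₂ Sub.sub (fun _ _ _ => Rel.subLeft _) fun _ _ _ => Rel.subRight _

noncomputable instance : Mul (FreeLeibniz K X) where
  mul := Quot.map₂ (· * ·) (fun _ _ _ => Rel.mul_left _) fun _ _ _ => Rel.mul_right _

noncomputable instance : NonUnitalNonAssocRing (FreeLeibniz K X) :=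
  Function.Surjective.nonUnitalNonAssocRing (Quot.mk (Rel K X)) Quot.mk_surjective rfl
    (fun _ _ => rfl) (fun _ _ => rfl) (fun _ => rfl) (fun _ _ => rfl) (fun _ _ => rfl)
    (fun _ _ => rfl)

noncomputable instance : Module K (FreeLeibniz K X) :=
  Function.Surjective.module K ⟨⟨Quot.mk (Rel K X), rfl⟩, fun _ _ => rfl⟩
    Quot.mk_surjective (fun _ _ => rfl)

instance : IsScalarTower K (FreeLeibniz K X) (FreeLeibniz K X) where
  smul_assoc := by
    rintro t ⟨a⟩ ⟨b⟩
    exact congrArg (Quot.mk (Rel K X)) (smul_mul_assoc t a b)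

instance : SMulCommClass K (FreeLeibniz K X) (FreeLeibniz K X) where
  smul_comm := by
    rintro t ⟨a⟩ ⟨b⟩
    exact congrArg (Quot.mk (Rel K X)) (mul_smul_comm t a b).symm

instance : IsLeibniz (FreeLeibniz K X) where
  leibniz := by
    rintro ⟨a⟩ ⟨b⟩ ⟨c⟩
    exact Quot.sound (Rel.leibniz a b c)

variable (K) in
/-- The free generator attached to a variable. -/
noncomputable def of (x : X) : FreeLeibniz K X :=
  Quot.mk _ (FreeNonUnitalNonAssocAlgebra.of K x)

variable (K) in
/-- The quotient map, as an algebra homomorphism. -/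
noncomputable def mk : FreeNonUnitalNonAssocAlgebra K X →ₙₐ[K] FreeLeibniz K X where
  toFun := Quot.mk (Rel K X)
  map_smul' _ _ := rfl
  map_zero' := rfl
  map_add' _ _ := rfl
  map_mul' _ _ := rfl

variable {A : Type*} [NonUnitalNonAssocRing A] [Module K A] [IsScalarTower K A A]
  [SMulCommClass K A A] [IsLeibniz A]

theorem lift_rel (f : X → A) (a b : FreeNonUnitalNonAssocAlgebra K X) (h : Rel K X a b) :
    FreeNonUnitalNonAssocAlgebra.lift K f a = FreeNonUnitalNonAssocAlgebra.lift K f b := by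
  induction h with
  | leibniz a b c => simp only [map_mul, map_sub, IsLeibniz.leibniz]
  | smul t _ ih => simp only [map_smul, ih]
  | add_right c _ ih => simp only [map_add, ih]
  | mul_left a _ ih => simp only [map_mul, ih]
  | mul_right c _ ih => simp only [map_mul, ih]

variable (K) in
/-- The universal property: maps from `X` to a Leibniz algebra `A` are the same thing as algebra
homomorphisms from the free Leibniz algebra to `A`. For a polynomial `f`, `lift K a f` is the
value of `f` under the evaluation `x ↦ a x`. -/
noncomputable def lift : (X → A) ≃ (FreeLeibniz K X →ₙₐ[K] A) where
  toFun f :=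
    { toFun := fun c => Quot.liftOn c (FreeNonUnitalNonAssocAlgebra.lift K f) (lift_rel f)
      map_smul' := by rintro t ⟨a⟩; exact map_smul (FreeNonUnitalNonAssocAlgebra.lift K f) t a
      map_zero' := map_zero (FreeNonUnitalNonAssocAlgebra.lift K f)
      map_add' := by rintro ⟨a⟩ ⟨b⟩; exact map_add (FreeNonUnitalNonAssocAlgebra.lift K f) a b
      map_mul' := by rintro ⟨a⟩ ⟨b⟩; exact map_mul (FreeNonUnitalNonAssocAlgebra.lift K f) a b }
  invFun F := F ∘ of K
  left_inv f := by
    ext x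
    exact FreeNonUnitalNonAssocAlgebra.lift_of_apply K f x
  right_inv F := by
    ext ⟨a⟩
    exact DFunLike.congr_fun (FreeNonUnitalNonAssocAlgebra.lift_comp_of K (F.comp (mk K))) a

@[simp]
theorem lift_of (f : X → A) (x : X) : lift K f (of K x) = f x :=
  FreeNonUnitalNonAssocAlgebra.lift_of_apply K f x

end FreeLeibniz

section TIdeals

variable {K : Type*} [Field K]

/-- A T-ideal of the free Leibniz algebra on countably many variables: a two-sided ideal that is
invariant under all endomorphisms. -/
structure IsTIdeal (I : Submodule K (FreeLeibniz K ℕ)) : Prop where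
  mul_left_mem : ∀ f g : FreeLeibniz K ℕ, g ∈ I → f * g ∈ I
  mul_right_mem : ∀ f g : FreeLeibniz K ℕ, g ∈ I → g * f ∈ I
  map_mem : ∀ φ : FreeLeibniz K ℕ →ₙₐ[K] FreeLeibniz K ℕ, ∀ g ∈ I, φ g ∈ I

/-- The T-ideal generated by `S`: the intersection of all T-ideals containing `S`. -/
noncomputable def tIdealSpan (S : Set (FreeLeibniz K ℕ)) : Submodule K (FreeLeibniz K ℕ) :=
  sInf {I | IsTIdeal I ∧ S ⊆ I}

theorem isTIdeal_tIdealSpan (S : Set (FreeLeibniz K ℕ)) : IsTIdeal (tIdealSpan S) := by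
  refine ⟨fun f g hg => ?_, fun f g hg => ?_, fun φ g hg => ?_⟩ <;>
    rw [tIdealSpan, Submodule.mem_sInf] at hg ⊢ <;> intro I hI
  · exact hI.1.mul_left_mem f g (hg I hI)
  · exact hI.1.mul_right_mem f g (hg I hI)
  · exact hI.1.map_mem φ g (hg I hI)

variable (K) in
/-- `T(A)`: the polynomial identities of a Leibniz algebra `A`, i.e. the polynomials that vanish
under every evaluation in `A`. -/
noncomputable def identitiesOf (A : Type*) [NonUnitalNonAssocRing A] [Module K A] [IsScalarTower K A A]
    [SMulCommClass K A A] [IsLeibniz A] : Submodule K (FreeLeibniz K ℕ) where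
  carrier := {f | ∀ a : ℕ → A, FreeLeibniz.lift K a f = 0}
  add_mem' := fun hf hg a => by rw [map_add, hf a, hg a, add_zero]
  zero_mem' := fun a => map_zero _
  smul_mem' := fun t f hf a => by rw [map_smul, hf a, smul_zero]

theorem isTIdeal_identitiesOf (A : Type*) [NonUnitalNonAssocRing A] [Module K A]
    [IsScalarTower K A A] [SMulCommClass K A A] [IsLeibniz A] :
    IsTIdeal (identitiesOf K A) where
  mul_left_mem f g hg a := by rw [map_mul, hg a, mul_zero]
  mul_right_mem f g hg a := by rw [map_mul, hg a, zero_mul]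
  map_mem φ g hg a := by
    have h := hg ((FreeLeibniz.lift K).symm ((FreeLeibniz.lift K a).comp φ))
    rw [Equiv.apply_symm_apply] at h
    exact h

/-- `S` is a basis of the T-ideal `I`, i.e. `I` is the T-ideal generated by `S`. -/
def IsTBasis (S : Set (FreeLeibniz K ℕ)) (I : Submodule K (FreeLeibniz K ℕ)) : Prop :=
  tIdealSpan S = I

end TIdeals

section Polynomials

variable {A : Type*} [NonUnitalNonAssocRing A]

/-- `a b^{(n)} = (⋯((a b) b)⋯) b`, with `n` factors `b`. -/
def mulIter (a b : A) (n : ℕ) : A := (fun t => t * b)^[n] a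

/-- The left-normed power `x^n = (⋯((x x) x)⋯) x`, with `n` factors `x`, for `n ≥ 1`. -/
def leftPow (x : A) (n : ℕ) : A := mulIter x x (n - 1)

/-- The standard polynomial `s₃`. -/
def standardThree (x y z : A) : A :=
  x * y * z - x * z * y - y * x * z + y * z * x + z * x * y - z * y * x

end Polynomials

section RR2

variable (K : Type*) [Field K] (α : K)

/-- The underlying space of the three-dimensional algebra `RR₂` with parameter `α`; coordinates
`0, 1, 2` are those with respect to `e₁, e₂, e₃`. -/
def RR2 (_α : K) : Type _ := Fin 3 → K

/-- The multiplication table: `e₁ e₃ = α e₁`, `e₃ e₂ = e₂`, `e₂ e₃ = -e₂`, and all other products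
of basis vectors are zero. The entry at `i`, `j` is the product of the basis vectors `i` and `j`. -/
def RR2.table : Fin 3 → Fin 3 → (Fin 3 → K) :=
  ![![0, 0, ![α, 0, 0]],
    ![0, 0, ![0, -1, 0]],
    ![0, ![0, 1, 0], 0]]

instance : AddCommGroup (RR2 K α) := inferInstanceAs (AddCommGroup (Fin 3 → K))

instance : Module K (RR2 K α) := inferInstanceAs (Module K (Fin 3 → K))

/-- The bilinear extension of the multiplication table. -/
instance : Mul (RR2 K α) where
  mul x y := ∑ i : Fin 3, ∑ j : Fin 3, ((x i * y j) • RR2.table K α i j : Fin 3 → K)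

theorem RR2.mul_def (x y : RR2 K α) :
    x * y = (![α * (x 0 * y 2), x 2 * y 1 - x 1 * y 2, 0] : Fin 3 → K) := by
  change (∑ i : Fin 3, ∑ j : Fin 3, ((x i * y j) • RR2.table K α i j : Fin 3 → K)) = _
  funext k
  fin_cases k <;> simp [Fin.sum_univ_three, RR2.table] <;> ring

theorem RR2.add_apply (x y : RR2 K α) (i : Fin 3) : (x + y) i = x i + y i := rfl

theorem RR2.sub_apply (x y : RR2 K α) (i : Fin 3) : (x - y) i = x i - y i := rfl

theorem RR2.zero_apply (i : Fin 3) : (0 : RR2 K α) i = 0 := rfl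

theorem RR2.smul_apply (t : K) (x : RR2 K α) (i : Fin 3) : (t • x) i = t * x i := rfl

theorem RR2.mul_apply_zero (x y : RR2 K α) : (x * y) 0 = α * (x 0 * y 2) := by
  rw [RR2.mul_def]; rfl

theorem RR2.mul_apply_one (x y : RR2 K α) : (x * y) 1 = x 2 * y 1 - x 1 * y 2 := by
  rw [RR2.mul_def]; rfl

theorem RR2.mul_apply_two (x y : RR2 K α) : (x * y) 2 = 0 := by
  rw [RR2.mul_def]; rfl

theorem RR2.ext {K : Type*} [Field K] {α : K} {x y : RR2 K α} (h0 : x 0 = y 0) (h1 : x 1 = y 1) (h2 : x 2 = y 2) : x = y := by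
  funext k
  fin_cases k
  · exact h0
  · exact h1
  · exact h2

instance : NonUnitalNonAssocRing (RR2 K α) where
  left_distrib x y z := by
    apply RR2.ext <;>
      simp only [RR2.add_apply, RR2.mul_apply_zero, RR2.mul_apply_one, RR2.mul_apply_two] <;> ring
  right_distrib x y z := by
    apply RR2.ext <;>
      simp only [RR2.add_apply, RR2.mul_apply_zero, RR2.mul_apply_one, RR2.mul_apply_two] <;> ring
  zero_mul x := by
    apply RR2.ext <;>
      simp only [RR2.zero_apply, RR2.mul_apply_zero, RR2.mul_apply_one, RR2.mul_apply_two] <;> ring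
  mul_zero x := by
    apply RR2.ext <;>
      simp only [RR2.zero_apply, RR2.mul_apply_zero, RR2.mul_apply_one, RR2.mul_apply_two] <;> ring

instance : IsScalarTower K (RR2 K α) (RR2 K α) where
  smul_assoc t x y := by
    simp only [smul_eq_mul]
    apply RR2.ext <;>
      simp only [RR2.smul_apply, RR2.mul_apply_zero, RR2.mul_apply_one, RR2.mul_apply_two] <;> ring

instance : SMulCommClass K (RR2 K α) (RR2 K α) where
  smul_comm t x y := by
    simp only [smul_eq_mul]
    apply RR2.ext <;>
      simp only [RR2.smul_apply, RR2.mul_apply_zero, RR2.mul_apply_one, RR2.mul_apply_two] <;> ring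

instance : IsLeibniz (RR2 K α) where
  leibniz x y z := by
    apply RR2.ext <;>
      simp only [RR2.sub_apply, RR2.mul_apply_zero, RR2.mul_apply_one, RR2.mul_apply_two] <;> ring

end RR2

/-! Soundness is a coordinate computation. For completeness, let `I` be a T-ideal of identities of
`RR₂` containing the listed polynomials, and let D be the image of the derived algebra in the
quotient by `I`. The metabelian identity makes right multiplications on D commute and makes products
act as zero, so D is a module over K[X₀, X₁, …] with X_i acting as right multiplication by x_i. The
Leibniz rule shows that the classes m(x_i, x_j) of the products x_i x_j generate it.

An identity f of `RR₂` has no linear part, hence is Σ r_ij m(x_i, x_j) modulo `I`. Evaluation in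
`RR₂` gives Σ_j r_ij(t) t_j = 0 from the e₁-coordinate and then Σ_i r_ij(t) t_i = 0 from the
e₂-coordinate, for all points t. It remains to deduce that the sum is zero in D.

If K is finite, the identities force R_y^q = R_y on D, so a nonzero element survives in a quotient
where each X_i acts by a scalar p_i (`exists_scalar_quotient`). There the sixth polynomial forces
m(x_i, x_j) to be a p_j-multiple of a term in i plus a p_i-multiple of a term in j, and the row and
column relations at p kill the sum. Only the first, third and sixth polynomials enter; the other
three are consequences.

If K is infinite, the relations on r are polynomial identities, and s₃ makes X^μ m(x_i, x_j) split
as u_i + v_j within each multidegree (`exists_splitting`). Again the rows kill one part and the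
columns the other. -/

theorem FiniteField.prod_X_sub_C_eq (K : Type*) [Field K] [Fintype K] :
    ∏ c : K, (Polynomial.X - Polynomial.C c) = Polynomial.X ^ Fintype.card K - Polynomial.X := by
  have hroots := FiniteField.roots_X_pow_card_sub_X K
  have hmonic : (Polynomial.X ^ Fintype.card K - Polynomial.X : Polynomial K).Monic :=
    Polynomial.monic_X_pow_sub (by
      rw [Polynomial.degree_X]
      exact_mod_cast Fintype.one_lt_card (α := K))
  have h := Polynomial.prod_multiset_X_sub_C_of_monic_of_roots_card_eq hmonic (by
    rw [hroots, FiniteField.X_pow_card_sub_X_natDegree_eq K Fintype.one_lt_card]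
    rfl)
  rw [hroots] at h
  exact h

theorem MvPolynomial.prod_X_sub_C_eq {K : Type*} [Field K] [Fintype K] {σ : Type*} (i : σ) :
    ∏ c : K, (X i - C c : MvPolynomial σ K) = X i ^ Fintype.card K - X i := by
  have h := congrArg (Polynomial.aeval (X i : MvPolynomial σ K))
    (FiniteField.prod_X_sub_C_eq K)
  simpa [map_prod, MvPolynomial.algebraMap_eq] using h

/-- Pairwise commuting elements of an algebra are the images of the variables under an algebra
homomorphism from a polynomial ring. -/
theorem MvPolynomial.exists_algHom_of_commute {K σ A : Type*} [CommRing K] [Ring A] [Algebra K A]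
    (s : σ → A) (h : ∀ i j, s i * s j = s j * s i) :
    ∃ φ : MvPolynomial σ K →ₐ[K] A, ∀ i, φ (X i) = s i := by
  have hcomm := Algebra.isMulCommutative_adjoin K (s := Set.range s)
    (by rintro _ ⟨i, rfl⟩ _ ⟨j, rfl⟩; exact h i j)
  let _ : CommRing (Algebra.adjoin K (Set.range s)) :=
    { (inferInstance : Ring (Algebra.adjoin K (Set.range s))) with
      mul_comm := hcomm.is_comm.comm }
  refine ⟨(Algebra.adjoin K (Set.range s)).val.comp (MvPolynomial.aeval fun i =>
    (⟨s i, Algebra.subset_adjoin ⟨i, rfl⟩⟩ : Algebra.adjoin K (Set.range s))), fun i => ?_⟩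
  simp

/-! ### Modules over the polynomial ring on which every variable satisfies t^q = t. -/

section FiniteCase

open MvPolynomial

variable {K V σ : Type*} [Field K] [AddCommGroup V] [Module K V]
  (φ : MvPolynomial σ K →ₐ[K] Module.End K V)

/-- The annihilator of a vector under an action of the polynomial ring. -/
def actionAnnihilator (v : V) : Ideal (MvPolynomial σ K) where
  carrier := {g | φ g v = 0}
  add_mem' {a b} ha hb := by
    have ha' : φ a v = 0 := ha
    have hb' : φ b v = 0 := hb
    simp [ha', hb']
  zero_mem' := by simp
  smul_mem' c a ha := by
    have ha' : φ a v = 0 := ha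
    simp [ha']

/-- The vectors that vanish in the localization at a prime ideal. -/
def localKernel (P : Ideal (MvPolynomial σ K)) [hP : P.IsPrime] : Submodule K V where
  carrier := {w | ∃ g, g ∉ P ∧ φ g w = 0}
  add_mem' := by
    rintro a b ⟨g, hg, hga⟩ ⟨h, hh, hhb⟩
    refine ⟨g * h, fun hgh => (hP.mem_or_mem hgh).elim hg hh, ?_⟩
    have h1 : φ (g * h) a = 0 := by rw [mul_comm, map_mul, Module.End.mul_apply, hga, map_zero]
    have h2 : φ (g * h) b = 0 := by rw [map_mul, Module.End.mul_apply, hhb, map_zero]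
    rw [map_add, h1, h2, add_zero]
  zero_mem' := ⟨1, fun h => hP.ne_top ((Ideal.eq_top_iff_one _).2 h), map_zero _⟩
  smul_mem' := by
    rintro c a ⟨g, hg, hga⟩
    exact ⟨g, hg, by rw [map_smul, hga, smul_zero]⟩

/-- If every variable acts with `t ^ q = t`, then each nonzero vector survives in a quotient on
which the variables act by scalars. -/
theorem exists_scalar_quotient [Fintype K]
    (hφ : ∀ i v, φ (X i ^ Fintype.card K) v = φ (X i) v) {v : V} (hv : v ≠ 0) :
    ∃ (p : σ → K) (N : Submodule K V), v ∉ N ∧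
      ∀ g w, N.mkQ (φ g w) = eval p g • N.mkQ w := by
  classical
  have hJ : actionAnnihilator φ v ≠ ⊤ := fun h => hv (by
    have h1 : (1 : MvPolynomial σ K) ∈ actionAnnihilator φ v := by rw [h]; trivial
    have h2 : φ 1 v = 0 := h1
    simpa using h2)
  obtain ⟨P, hmax, hle⟩ := Ideal.exists_le_maximal _ hJ
  have hP : P.IsPrime := hmax.isPrime
  have hprod : ∀ i w, φ (∏ c : K, (X i - C c)) w = 0 := fun i w => by
    rw [MvPolynomial.prod_X_sub_C_eq, map_sub, LinearMap.sub_apply, hφ, sub_self]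
  have hex : ∀ i, ∃ c : K, (X i - C c : MvPolynomial σ K) ∈ P := fun i => by
    have hm : ∏ c : K, (X i - C c : MvPolynomial σ K) ∈ P := hle (hprod i v)
    obtain ⟨c, -, hc⟩ := Ideal.IsPrime.prod_mem_iff.1 hm
    exact ⟨c, hc⟩
  choose p hp using hex
  have hN : ∀ i w, φ (X i) w - p i • w ∈ localKernel φ P := fun i w => by
    -- Dropping the factor at `p i` leaves a product outside `P`: two factors in `P` would differ by
    -- a unit. Restoring that factor gives X^q - X, which acts as zero.
    refine ⟨∏ c ∈ Finset.univ.erase (p i), (X i - C c), fun hm => ?_, ?_⟩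
    · obtain ⟨c, hc, hcm⟩ := Ideal.IsPrime.prod_mem_iff.1 hm
      have hd : (C (c - p i) : MvPolynomial σ K) ∈ P := by
        have := P.sub_mem (hp i) hcm
        simpa using this
      have hne : c - p i ≠ 0 := sub_ne_zero.2 (Finset.ne_of_mem_erase hc)
      exact hP.ne_top (Ideal.eq_top_of_isUnit_mem _ hd (hne.isUnit.map C))
    · have h1 : φ (X i) w - p i • w = φ (X i - C (p i)) w := by
        simp [← MvPolynomial.algebraMap_eq, Algebra.algebraMap_eq_smul_one]
      rw [h1, ← Module.End.mul_apply, ← map_mul,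
        Finset.prod_erase_mul _ _ (Finset.mem_univ (p i)), hprod]
  refine ⟨p, localKernel φ P, ?_, ?_⟩
  · rintro ⟨g, hg, hgv⟩
    exact hg (hle hgv)
  · intro g
    induction g using MvPolynomial.induction_on with
    | C a =>
      intro w
      simp [← MvPolynomial.algebraMap_eq, Algebra.algebraMap_eq_smul_one]
    | add a b ha hb =>
      intro w
      rw [map_add, LinearMap.add_apply, map_add, ha, hb, map_add, add_smul]
    | mul_X a i ha =>
      intro w
      rw [map_mul, Module.End.mul_apply, ha, map_mul, eval_X, mul_smul]
      congr 1
      have := hN i w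
      rw [← map_smul, ← sub_eq_zero, ← map_sub]
      exact (Submodule.Quotient.mk_eq_zero _).2 this

/-- In a scalar quotient, correct each x_i to y_i = x_i - p_i w acting as zero. Then `hm` at (y_i,
y_j) reduces to m(y_i, y_j) = 0, and bilinearity expresses m(x_i, x_j) in a form annihilated by the
row and column relations. -/
theorem sum_action_eq_zero_of_finite [Fintype K] {L : Type*} [AddCommGroup L] [Module K L]
    (R : L →ₗ[K] Module.End K V) (m : L →ₗ[K] L →ₗ[K] V) (x : σ → L)
    (hR : ∀ i, φ (X i) = R (x i))
    (hpow : ∀ y v, (R y ^ Fintype.card K) v = R y v)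
    (hm : ∀ y z, (R y ^ (Fintype.card K - 1)) ((R z ^ (Fintype.card K - 1)) (m y z))
      - (R y ^ (Fintype.card K - 1)) (m y z) - (R z ^ (Fintype.card K - 1)) (m y z)
      + m y z = 0)
    (s : Finset σ) (r : σ → σ → MvPolynomial σ K)
    (hrow : ∀ t : σ → K, ∀ i ∈ s, ∑ j ∈ s, eval t (r i j) * t j = 0)
    (hcol : ∀ t : σ → K, ∀ j ∈ s, ∑ i ∈ s, eval t (r i j) * t i = 0) :
    ∑ i ∈ s, ∑ j ∈ s, φ (r i j) (m (x i) (x j)) = 0 := by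
  by_contra hv
  obtain ⟨p, N, hvN, hN⟩ := exists_scalar_quotient φ
    (fun i v => by rw [map_pow, hR, hpow]) hv
  -- If some p_k is nonzero, x_k / p_k acts as the identity on the quotient; the factor `p i` makes
  -- the case p = 0 vacuous.
  have hw : ∃ w : L, ∀ i v, p i • N.mkQ (R w v) = p i • N.mkQ v := by
    by_cases hp : ∀ i, p i = 0
    · exact ⟨0, fun i v => by simp [hp i]⟩
    · push Not at hp
      obtain ⟨k, hk⟩ := hp
      refine ⟨(p k)⁻¹ • x k, fun i v => ?_⟩
      rw [map_smul, ← hR, LinearMap.smul_apply, map_smul, hN, eval_X, inv_smul_smul₀ hk]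
  obtain ⟨w, hw⟩ := hw
  have hy : ∀ i v, N.mkQ (R (x i - p i • w) v) = 0 := fun i v => by
    rw [map_sub, map_smul, LinearMap.sub_apply, LinearMap.smul_apply, map_sub, map_smul, hw, ← hR,
      hN, eval_X, sub_self]
  have hq : Fintype.card K - 1 ≠ 0 := by
    have := Fintype.one_lt_card (α := K)
    omega
  have hypow : ∀ i v, N.mkQ ((R (x i - p i • w) ^ (Fintype.card K - 1)) v) = 0 := fun i v => by
    obtain ⟨n, hn⟩ := Nat.exists_eq_succ_of_ne_zero hq
    rw [hn, pow_succ', Module.End.mul_apply, hy]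
  have hyy : ∀ i j, N.mkQ (m (x i - p i • w) (x j - p j • w)) = 0 := fun i j => by
    have h := congrArg N.mkQ (hm (x i - p i • w) (x j - p j • w))
    rw [map_add, map_sub, map_sub, hypow, hypow, hypow] at h
    simpa using h
  have hxx : ∀ i j, N.mkQ (m (x i) (x j)) = p j • N.mkQ (m (x i) w)
      + p i • (N.mkQ (m w (x j)) - p j • N.mkQ (m w w)) := fun i j => by
    have h := hyy i j
    simp only [map_sub, map_smul, LinearMap.sub_apply, LinearMap.smul_apply] at h
    rw [← sub_eq_zero, ← h]
    module
  apply hvN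
  rw [← Submodule.Quotient.mk_eq_zero, ← Submodule.mkQ_apply]
  simp only [map_sum, hN, hxx, smul_add, ← mul_smul, Finset.sum_add_distrib]
  have h1 : ∑ i ∈ s, ∑ j ∈ s, (eval p (r i j) * p j) • N.mkQ (m (x i) w) = 0 :=
    Finset.sum_eq_zero fun i hi => by rw [← Finset.sum_smul, hrow p i hi, zero_smul]
  have h2 : ∑ i ∈ s, ∑ j ∈ s, (eval p (r i j) * p i) •
      (N.mkQ (m w (x j)) - p j • N.mkQ (m w w)) = 0 := by
    rw [Finset.sum_comm]
    exact Finset.sum_eq_zero fun j hj => by rw [← Finset.sum_smul, hcol p j hj, zero_smul]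
  rw [h1, h2, add_zero]

end FiniteCase

/-! ### Splitting the generators in each multidegree. -/

section InfiniteCase

open MvPolynomial

variable {K V σ : Type*} [Field K] [AddCommGroup V] [Module K V]
  (φ : MvPolynomial σ K →ₐ[K] Module.End K V) (m : σ → σ → V)

/-- Within each multidegree, the generators split as a sum of a part depending on the first
index and a part depending on the second one. -/
theorem exists_splitting
    (hquad : ∀ i j k l, φ (X k * X l) (m i j) - φ (X k * X j) (m i l)
      = φ (X i * X l) (m k j) - φ (X i * X j) (m k l))
    (hcyc : ∀ i j k, φ (X k) (m i j) - φ (X j) (m i k) - φ (X k) (m j i) + φ (X i) (m j k)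
      + φ (X j) (m k i) - φ (X i) (m k j) = 0) (ν : σ →₀ ℕ) :
    ∃ u v : σ → V, ∀ i j μ, μ + Finsupp.single i 1 + Finsupp.single j 1 = ν →
      φ (monomial μ 1) (m i j) = u i + v j := by
  classical
  -- Truncated subtraction makes `N` total; its value matters only when X_i X_j divides X^ν.
  set N : σ → σ → V := fun i j =>
    φ (monomial (ν - Finsupp.single i 1 - Finsupp.single j 1) 1) (m i j) with hNdef
  have hN : ∀ {i j μ}, μ + Finsupp.single i 1 + Finsupp.single j 1 = ν →
      φ (monomial μ 1) (m i j) = N i j := by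
    intro i j μ h
    have : ν - Finsupp.single i 1 - Finsupp.single j 1 = μ := by
      rw [← h, add_right_comm, add_tsub_cancel_right, add_tsub_cancel_right]
    simp only [hNdef, this]
  have hmon : ∀ (κ : σ →₀ ℕ) i, φ (monomial κ (1 : K)) ∘ₗ φ (X i)
      = φ (monomial (κ + Finsupp.single i 1) 1) := fun κ i => by
    rw [← Module.End.mul_eq_comp, ← map_mul, X, monomial_mul, mul_one]
  have hmon' : ∀ (κ : σ →₀ ℕ) i v, φ (monomial κ (1 : K)) (φ (X i) v)
      = φ (monomial (κ + Finsupp.single i 1) 1) v := fun κ i v => by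
    rw [← hmon]; rfl
  have hmon2 : ∀ (κ : σ →₀ ℕ) i j v, φ (monomial κ (1 : K)) (φ (X i * X j) v)
      = φ (monomial (κ + Finsupp.single i 1 + Finsupp.single j 1) 1) v := fun κ i j v => by
    rw [map_mul, Module.End.mul_apply, hmon', hmon']
  have hQ : ∀ i j k l, Finsupp.single i 1 + Finsupp.single j 1 + Finsupp.single k 1
      + Finsupp.single l 1 ≤ ν → N i j - N i l = N k j - N k l := by
    intro i j k l hle
    obtain ⟨κ, rfl⟩ := exists_add_of_le hle
    have h := congrArg (φ (monomial κ (1 : K))) (hquad i j k l)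
    simp only [map_sub, hmon2] at h
    rw [hN (i := i) (j := j) (by abel), hN (i := i) (j := l) (by abel),
      hN (i := k) (j := j) (by abel), hN (i := k) (j := l) (by abel)] at h
    exact h
  have hC : ∀ i j k, Finsupp.single i 1 + Finsupp.single j 1 + Finsupp.single k 1 ≤ ν →
      N i j - N i k - N j i + N j k + N k i - N k j = 0 := by
    intro i j k hle
    obtain ⟨κ, rfl⟩ := exists_add_of_le hle
    have h := congrArg (φ (monomial κ (1 : K))) (hcyc i j k)
    simp only [map_sub, map_add, hmon', map_zero] at h
    rw [hN (i := i) (j := j) (by abel), hN (i := i) (j := k) (by abel),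
      hN (i := j) (j := i) (by abel), hN (i := j) (j := k) (by abel),
      hN (i := k) (j := i) (by abel), hN (i := k) (j := j) (by abel)] at h
    exact h
  clear_value N
  suffices H : ∃ u v : σ → V, ∀ i j, Finsupp.single i 1 + Finsupp.single j 1 ≤ ν →
      N i j = u i + v j by
    obtain ⟨u, v, H⟩ := H
    refine ⟨u, v, fun i j μ h => ?_⟩
    rw [hN h, H]
    rw [← h, add_assoc]
    exact le_add_self
  by_cases hk : ∃ k, 2 ≤ ν k
  · obtain ⟨k, hk⟩ := hk
    -- A repeated variable k serves as base point: `N k k` is meaningful, and the exchange relation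
    -- on rows i, k and columns j, k is the splitting.
    refine ⟨fun i => N i k, fun j => N k j - N k k, fun i j hij => ?_⟩
    beta_reduce
    by_cases hi : i = k
    · subst hi; abel
    by_cases hj : j = k
    · subst hj; abel
    have h := hQ i j k k (fun a => by
      have := hij a
      simp only [Finsupp.add_apply, Finsupp.single_apply] at this ⊢
      by_cases hak : k = a
      · subst hak; simp [hi, hj]; omega
      · simpa [hak] using this)
    rw [sub_eq_iff_eq_add] at h
    rw [h]; abel
  push Not at hk
  have hne : ∀ i j, Finsupp.single i 1 + Finsupp.single j 1 ≤ ν → i ≠ j ∧ ν i = 1 ∧ ν j = 1 := by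
    intro i j hij
    have h1 := hij i
    have h2 := hij j
    have h3 := hk i
    have h4 := hk j
    simp only [Finsupp.add_apply, Finsupp.single_apply] at h1 h2
    by_cases h : i = j
    · subst h; simp at h1; omega
    · refine ⟨h, ?_, ?_⟩
      · simp at h1; omega
      · simp at h2; omega
  -- In the squarefree case diagonal entries carry no information, so only exchanges avoiding the
  -- diagonal are available.
  have hQ' : ∀ i j k l, ν i = 1 → ν j = 1 → ν k = 1 → ν l = 1 → i ≠ j → i ≠ l → k ≠ j → k ≠ l →
      N i j - N i l = N k j - N k l := by
    intro i j k l h1 h2 h3 h4 hij hil hkj hkl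
    by_cases hik : i = k
    · rw [hik]
    by_cases hjl : j = l
    · rw [hjl, sub_self, sub_self]
    refine hQ i j k l fun a => ?_
    simp only [Finsupp.add_apply, Finsupp.single_apply]
    by_cases ha : i = a
    · subst ha; simp [Ne.symm hij, Ne.symm hil, Ne.symm hik, h1]
    by_cases hb : j = a
    · subst hb; simp [hij, hkj, Ne.symm hjl, h2]
    by_cases hc : k = a
    · subst hc; simp [ha, hb, Ne.symm hkl, h3]
    by_cases hd : l = a
    · subst hd; simp [hil, hjl, hkl, h4]
    simp [ha, hb, hc, hd]
  by_cases h3 : ∃ a b c, a ≠ b ∧ a ≠ c ∧ b ≠ c ∧ ν a = 1 ∧ ν b = 1 ∧ ν c = 1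
  · obtain ⟨a, b, c, hab, hac, hbc, ha, hb, hc⟩ := h3
    have hcyc' := hC a b c fun d => by
      simp only [Finsupp.add_apply, Finsupp.single_apply]
      by_cases h : a = d
      · subst h; simp [Ne.symm hab, Ne.symm hac, ha]
      by_cases h' : b = d
      · subst h'; simp [hab, Ne.symm hbc, hb]
      by_cases h'' : c = d
      · subst h''; simp [hac, hbc, hc]
      simp [h, h', h'']
    -- Normalizing u_a = 0 forces v_j = N_aj for j ≠ a. Then u_b is read off column c, the other u_i
    -- off column b, and v_a off the entry (b, a). Only consistency in column a needs the cyclic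
    -- relation.
    refine ⟨fun i => if i = a then 0 else if i = b then N b c - N a c else N i b - N a b,
      fun j => if j = a then N b a - (N b c - N a c) else N a j, fun i j hij => ?_⟩
    obtain ⟨hij, hi, hj⟩ := hne i j hij
    by_cases hia : i = a
    · subst hia; simp [Ne.symm hij]
    by_cases hja : j = a
    · subst hja
      by_cases hib : i = b
      · subst hib; simp [hij]
      · have h : N i j - N i b = N c j - N c b := by
          by_cases hic : i = c
          · rw [hic]
          exact hQ' i j c b hi ha hc hb hij hib (Ne.symm hac) (Ne.symm hbc)
        simp only [hia, hib, if_true, if_false]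
        rw [sub_eq_iff_eq_add] at h
        rw [h, ← sub_eq_zero, ← hcyc']
        abel
    · by_cases hib : i = b
      · subst hib
        have h := hQ' i j a c hi hj ha hc hij hbc (Ne.symm hja) hac
        simp only [hia, hja, if_true, if_false]
        rw [sub_eq_iff_eq_add] at h
        rw [h]; abel
      · have h := hQ' i j a b hi hj ha hb hij hib (Ne.symm hja) hab
        simp only [hia, hja, hib, if_false]
        rw [sub_eq_iff_eq_add] at h
        rw [h]; abel
  · by_cases h2 : ∃ a b, a ≠ b ∧ ν a = 1 ∧ ν b = 1
    · obtain ⟨a, b, hab, ha, hb⟩ := h2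
      -- With just two variables the only relevant entries are (a, b) and (b, a), so the row alone
      -- determines the value.
      refine ⟨fun i => if i = a then N a b else N b a, fun _ => 0, fun i j hij => ?_⟩
      obtain ⟨hij, hi, hj⟩ := hne i j hij
      have hmem : ∀ d, ν d = 1 → d = a ∨ d = b := fun d hd => by
        by_contra! hcon
        exact h3 ⟨a, b, d, hab, hcon.1.symm, hcon.2.symm, ha, hb, hd⟩
      rcases hmem i hi with rfl | rfl <;> rcases hmem j hj with rfl | rfl
      · exact absurd rfl hij
      · simp
      · simp [hij]
      · exact absurd rfl hij
    · refine ⟨0, 0, fun i j hij => ?_⟩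
      exact absurd ⟨i, j, hne i j hij⟩ h2

/-- Extending the splittings linearly over monomials gives maps U_i, W_j with g·m_ij = U_i(g X_i
X_j) + W_j(g X_i X_j). Summing with g = r_ij produces U_i(X_i Σ_j r_ij X_j) and W_j(X_j Σ_i r_ij
X_i), which vanish because over an infinite field the pointwise relations are polynomial ones. -/
theorem sum_action_eq_zero_of_infinite [Infinite K]
    (hquad : ∀ i j k l, φ (X k * X l) (m i j) - φ (X k * X j) (m i l)
      = φ (X i * X l) (m k j) - φ (X i * X j) (m k l))
    (hcyc : ∀ i j k, φ (X k) (m i j) - φ (X j) (m i k) - φ (X k) (m j i) + φ (X i) (m j k)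
      + φ (X j) (m k i) - φ (X i) (m k j) = 0)
    (s : Finset σ) (r : σ → σ → MvPolynomial σ K)
    (hrow : ∀ t : σ → K, ∀ i ∈ s, ∑ j ∈ s, eval t (r i j) * t j = 0)
    (hcol : ∀ t : σ → K, ∀ j ∈ s, ∑ i ∈ s, eval t (r i j) * t i = 0) :
    ∑ i ∈ s, ∑ j ∈ s, φ (r i j) (m i j) = 0 := by
  choose u v huv using exists_splitting φ m hquad hcyc
  let U : σ → MvPolynomial σ K →ₗ[K] V := fun i =>
    (basisMonomials σ K).constr K fun ν => u ν i
  let W : σ → MvPolynomial σ K →ₗ[K] V := fun j =>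
    (basisMonomials σ K).constr K fun ν => v ν j
  have hU : ∀ i ν, U i (monomial ν 1) = u ν i := fun i ν => by
    simpa using (basisMonomials σ K).constr_basis K (fun ν => u ν i) ν
  have hW : ∀ j ν, W j (monomial ν 1) = v ν j := fun j ν => by
    simpa using (basisMonomials σ K).constr_basis K (fun ν => v ν j) ν
  have key : ∀ i j g, φ g (m i j) = U i (g * X i * X j) + W j (g * X i * X j) := by
    intro i j g
    induction g using MvPolynomial.induction_on' with
    | monomial μ a =>
      have h : (monomial μ a : MvPolynomial σ K) = a • monomial μ 1 := by
        rw [smul_monomial, smul_eq_mul, mul_one]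
      have h' : (monomial μ 1 : MvPolynomial σ K) * X i * X j
          = monomial (μ + Finsupp.single i 1 + Finsupp.single j 1) 1 := by
        simp only [X, monomial_mul, mul_one]
      rw [h, map_smul, LinearMap.smul_apply, smul_mul_assoc, smul_mul_assoc, map_smul, map_smul,
        h', hU, hW, ← smul_add, huv _ i j μ rfl]
    | add p q hp hq =>
      rw [map_add, LinearMap.add_apply, hp, hq, add_mul, add_mul, map_add, map_add]
      abel
  simp only [key, Finset.sum_add_distrib]
  have h1 : ∑ i ∈ s, ∑ j ∈ s, U i (r i j * X i * X j) = 0 := Finset.sum_eq_zero fun i hi => by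
    have h0 : ∑ j ∈ s, r i j * X j = 0 := MvPolynomial.funext fun t => by
      simpa using hrow t i hi
    rw [← map_sum, ← map_zero (U i), ← mul_zero (X i), ← h0, Finset.mul_sum]
    exact congrArg _ (Finset.sum_congr rfl fun j _ => by ring)
  have h2 : ∑ i ∈ s, ∑ j ∈ s, W j (r i j * X i * X j) = 0 := by
    rw [Finset.sum_comm]
    refine Finset.sum_eq_zero fun j hj => ?_
    have h0 : ∑ i ∈ s, r i j * X i = 0 := MvPolynomial.funext fun t => by
      simpa using hcol t j hj
    rw [← map_sum, ← map_zero (W j), ← zero_mul (X j), ← h0, Finset.sum_mul]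
  rw [h1, h2, add_zero]

end InfiniteCase

/-! ### Induction in the free Leibniz algebra and naturality of the iterated products. -/

theorem FreeLeibniz.mem_of_mul_closed {K : Type*} [Field K] {X : Type*}
    (S : Submodule K (FreeLeibniz K X)) (hof : ∀ i, of K i ∈ S)
    (hmul : ∀ a b, a ∈ S → b ∈ S → a * b ∈ S) (f : FreeLeibniz K X) : f ∈ S := by
  let S' : NonUnitalSubalgebra K (FreeLeibniz K X) :=
    { S with mul_mem' := fun {a b} ha hb => hmul a b ha hb }
  have : IsLeibniz S' := ⟨fun x y z => Subtype.ext (IsLeibniz.leibniz _ _ _)⟩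
  -- By the universal property, the lift into the subalgebra followed by inclusion is the identity.
  have h : (NonUnitalSubalgebraClass.subtype S').comp
      (lift K fun i => (⟨of K i, hof i⟩ : S')) = NonUnitalAlgHom.id K (FreeLeibniz K X) := by
    apply (lift K).symm.injective
    funext i
    change ((lift K fun i => (⟨of K i, hof i⟩ : S')) (of K i) : FreeLeibniz K X) = of K i
    rw [lift_of]
  have h' := DFunLike.congr_fun h f
  rw [← show ((lift K fun i => (⟨of K i, hof i⟩ : S')) f : FreeLeibniz K X) = f from h']
  exact ((lift K fun i => (⟨of K i, hof i⟩ : S')) f).2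

theorem mulIter_zero {A : Type*} [NonUnitalNonAssocRing A] (a b : A) : mulIter a b 0 = a := rfl

theorem mulIter_succ {A : Type*} [NonUnitalNonAssocRing A] (a b : A) (n : ℕ) :
    mulIter a b (n + 1) = mulIter a b n * b :=
  Function.iterate_succ_apply' _ _ _

theorem mulIter_succ' {A : Type*} [NonUnitalNonAssocRing A] (a b : A) (n : ℕ) :
    mulIter a b (n + 1) = mulIter (a * b) b n := rfl

theorem map_mulIter {K A B : Type*} [Field K] [NonUnitalNonAssocRing A] [Module K A]
    [NonUnitalNonAssocRing B] [Module K B] (φ : A →ₙₐ[K] B) (a b : A) (n : ℕ) :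
    φ (mulIter a b n) = mulIter (φ a) (φ b) n := by
  induction n with
  | zero => rfl
  | succ n ih => rw [mulIter_succ, mulIter_succ, map_mul, ih]

theorem map_leftPow {K A B : Type*} [Field K] [NonUnitalNonAssocRing A] [Module K A]
    [NonUnitalNonAssocRing B] [Module K B] (φ : A →ₙₐ[K] B) (a : A) (n : ℕ) :
    φ (leftPow a n) = leftPow (φ a) n :=
  map_mulIter φ a a (n - 1)

theorem map_standardThree {K A B : Type*} [Field K] [NonUnitalNonAssocRing A] [Module K A]
    [NonUnitalNonAssocRing B] [Module K B] (φ : A →ₙₐ[K] B) (a b c : A) :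
    φ (standardThree a b c) = standardThree (φ a) (φ b) (φ c) := by
  simp only [standardThree, map_sub, map_add, map_mul]

/-! ### The derived algebra modulo a T-ideal as a module over the polynomial ring. -/

section DerivedQuotient

open MvPolynomial

variable {K : Type*} [Field K] {I : Submodule K (FreeLeibniz K ℕ)}

/-- The image of the derived algebra in the quotient by `I`. -/
noncomputable def derivedQuotient (I : Submodule K (FreeLeibniz K ℕ)) : Submodule K (FreeLeibniz K ℕ ⧸ I) :=
  Submodule.span K {v | ∃ a b : FreeLeibniz K ℕ, v = I.mkQ (a * b)}

/-- The class of a product. -/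
noncomputable def mulClass (I : Submodule K (FreeLeibniz K ℕ)) :
    FreeLeibniz K ℕ →ₗ[K] FreeLeibniz K ℕ →ₗ[K] derivedQuotient I :=
  LinearMap.mk₂ K (fun a b => ⟨I.mkQ (a * b), Submodule.subset_span ⟨a, b, rfl⟩⟩)
    (fun a b c => Subtype.ext (by simp [add_mul]))
    (fun t a b => Subtype.ext (by simp [smul_mul_assoc]))
    (fun a b c => Subtype.ext (by simp [mul_add]))
    (fun t a b => Subtype.ext (by simp [mul_smul_comm]))

theorem coe_mulClass (a b : FreeLeibniz K ℕ) :
    (mulClass I a b : FreeLeibniz K ℕ ⧸ I) = I.mkQ (a * b) := rfl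

theorem mkQ_eq_mkQ_iff {a b : FreeLeibniz K ℕ} : I.mkQ a = I.mkQ b ↔ a - b ∈ I := by
  rw [Submodule.mkQ_apply, Submodule.mkQ_apply, Submodule.Quotient.eq]

theorem mkQ_eq_zero_iff {a : FreeLeibniz K ℕ} : I.mkQ a = 0 ↔ a ∈ I := by
  rw [Submodule.mkQ_apply, Submodule.Quotient.mk_eq_zero]

theorem mulClass_eq_zero {a b : FreeLeibniz K ℕ} (h : a * b ∈ I) : mulClass I a b = 0 :=
  Subtype.ext (mkQ_eq_zero_iff.2 h)

theorem derivedQuotient_induction {W : Submodule K (derivedQuotient I)}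
    (h : ∀ a b, mulClass I a b ∈ W) (v : derivedQuotient I) : v ∈ W := by
  have hle : derivedQuotient I ≤ W.map (derivedQuotient I).subtype :=
    Submodule.span_le.2 (by
      rintro _ ⟨a, b, rfl⟩
      exact ⟨mulClass I a b, h a b, rfl⟩)
  obtain ⟨w, hw, hwv⟩ := hle v.2
  rwa [← show w = v from Subtype.ext hwv]

theorem derivedQuotient_linearMap_ext {V : Type*} [AddCommGroup V] [Module K V]
    {f g : derivedQuotient I →ₗ[K] V} (h : ∀ a b, f (mulClass I a b) = g (mulClass I a b)) :
    f = g := by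
  ext v
  have := derivedQuotient_induction (W := LinearMap.eqLocus f g) h v
  exact this

/-- Right multiplication on the image of the derived algebra. -/
noncomputable def rightMul (hI : IsTIdeal I) :
    FreeLeibniz K ℕ →ₗ[K] Module.End K (derivedQuotient I) where
  toFun h := LinearMap.restrict
    (I.mapQ I (LinearMap.mulRight K h) fun g hg => hI.mul_right_mem h g hg) (fun v hv => by
      have : derivedQuotient I ≤ (derivedQuotient I).comap
          (I.mapQ I (LinearMap.mulRight K h) fun g hg => hI.mul_right_mem h g hg) :=
        Submodule.span_le.2 (by
          rintro _ ⟨a, b, rfl⟩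
          exact Submodule.subset_span ⟨a * b, h, rfl⟩)
      exact this hv)
  map_add' h k := derivedQuotient_linearMap_ext fun a b => Subtype.ext
    (congrArg I.mkQ (mul_add (a * b) h k))
  map_smul' t h := derivedQuotient_linearMap_ext fun a b => Subtype.ext
    (congrArg I.mkQ (mul_smul_comm t (a * b) h))

theorem rightMul_mulClass (hI : IsTIdeal I) (h a b : FreeLeibniz K ℕ) :
    rightMul hI h (mulClass I a b) = mulClass I (a * b) h := rfl

theorem coe_rightMul_pow_mulClass (hI : IsTIdeal I) (h a b : FreeLeibniz K ℕ) (n : ℕ) :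
    ((rightMul hI h ^ n) (mulClass I a b) : FreeLeibniz K ℕ ⧸ I)
      = I.mkQ (mulIter (a * b) h n) := by
  induction n generalizing a b with
  | zero => rfl
  | succ n ih =>
    rw [pow_succ, Module.End.mul_apply, rightMul_mulClass, ih, mulIter_succ']

theorem mulClass_mul (hI : IsTIdeal I) (a b c : FreeLeibniz K ℕ) :
    mulClass I a (b * c) = rightMul hI c (mulClass I a b) - rightMul hI b (mulClass I a c) :=
  Subtype.ext (by
    change I.mkQ (a * (b * c)) = I.mkQ (a * b * c) - I.mkQ (a * c * b)
    rw [IsLeibniz.leibniz, map_sub])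

section Metabelian

variable (hI : IsTIdeal I) (hmet : ∀ a b c d : FreeLeibniz K ℕ, (a * b) * (c * d) ∈ I)
include hmet

theorem rightMul_mul (a b : FreeLeibniz K ℕ) : rightMul hI (a * b) = 0 :=
  derivedQuotient_linearMap_ext fun c d => mulClass_eq_zero (hmet c d a b)

theorem rightMul_comm (h k : FreeLeibniz K ℕ) :
    rightMul hI h * rightMul hI k = rightMul hI k * rightMul hI h :=
  derivedQuotient_linearMap_ext fun a b => by
    have h0 := mulClass_mul hI (a * b) k h
    rw [mulClass_eq_zero (hmet a b k h)] at h0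
    exact (sub_eq_zero.1 h0.symm)

theorem exists_action : ∃ φ : MvPolynomial ℕ K →ₐ[K] Module.End K (derivedQuotient I),
    ∀ i, φ (X i) = rightMul hI (FreeLeibniz.of K i) :=
  MvPolynomial.exists_algHom_of_commute (A := Module.End K (derivedQuotient I)) _ fun _ _ => rightMul_comm hI hmet _ _

/-- A product in the second argument is removed by the Leibniz rule, and one in the first is itself
a class on which right multiplication acts. Induction on both arguments reduces to pairs of
generators. -/
theorem exists_sum_action (φ : MvPolynomial ℕ K →ₐ[K] Module.End K (derivedQuotient I))
    (hφ : ∀ i, φ (X i) = rightMul hI (FreeLeibniz.of K i)) (v : derivedQuotient I) :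
    ∃ (s : Finset ℕ) (r : ℕ → ℕ → MvPolynomial ℕ K),
      v = ∑ i ∈ s, ∑ j ∈ s,
        φ (r i j) (mulClass I (FreeLeibniz.of K i) (FreeLeibniz.of K j)) := by
  classical
  let Ψ : (ℕ × ℕ →₀ MvPolynomial ℕ K) →ₗ[K] derivedQuotient I :=
    Finsupp.lsum K fun p => (LinearMap.applyₗ
      (mulClass I (FreeLeibniz.of K p.1) (FreeLeibniz.of K p.2))).comp φ.toLinearMap
  have hΨ : ∀ i j g, Ψ (Finsupp.single (i, j) g)
      = φ g (mulClass I (FreeLeibniz.of K i) (FreeLeibniz.of K j)) := fun i j g => by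
    simp [Ψ]
  have hW : ∀ g v, v ∈ LinearMap.range Ψ → φ g v ∈ LinearMap.range Ψ := by
    rintro g _ ⟨r, rfl⟩
    induction r using Finsupp.induction_linear with
    | zero => simp
    | add a b ha hb => rw [map_add, map_add]; exact add_mem ha hb
    | single p h =>
      exact ⟨Finsupp.single p (g * h), by rw [hΨ, hΨ, map_mul, Module.End.mul_apply]⟩
  have hR : ∀ h, ∃ g, rightMul hI h = φ g := fun h => by
    have := FreeLeibniz.mem_of_mul_closed
      ((LinearMap.range φ.toLinearMap).comap (rightMul hI)) (fun i => ⟨X i, hφ i⟩)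
      (fun a b _ _ => ⟨0, by simp [rightMul_mul hI hmet]⟩) h
    obtain ⟨g, hg⟩ := this
    exact ⟨g, hg.symm⟩
  have hRW : ∀ h v, v ∈ LinearMap.range Ψ → rightMul hI h v ∈ LinearMap.range Ψ := by
    intro h v hv
    obtain ⟨g, hg⟩ := hR h
    rw [hg]
    exact hW g v hv
  have hsecond : ∀ a, (∀ j, mulClass I a (FreeLeibniz.of K j) ∈ LinearMap.range Ψ) →
      ∀ b, mulClass I a b ∈ LinearMap.range Ψ := fun a ha b =>
    FreeLeibniz.mem_of_mul_closed ((LinearMap.range Ψ).comap (mulClass I a)) ha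
      (fun c d hc hd => by
        rw [Submodule.mem_comap] at hc hd ⊢
        rw [mulClass_mul hI]
        exact sub_mem (hRW _ _ hc) (hRW _ _ hd)) b
  have hfirst : ∀ a b, mulClass I a b ∈ LinearMap.range Ψ := fun a => hsecond a fun j => by
    revert j
    have := FreeLeibniz.mem_of_mul_closed
      (⨅ j, (LinearMap.range Ψ).comap ((mulClass I).flip (FreeLeibniz.of K j)))
      (fun i => by
        simp only [Submodule.mem_iInf, Submodule.mem_comap, LinearMap.flip_apply]
        exact fun j => ⟨Finsupp.single (i, j) 1, by rw [hΨ, map_one]; rfl⟩)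
      (fun c d hc hd => by
        simp only [Submodule.mem_iInf, Submodule.mem_comap, LinearMap.flip_apply] at hc hd ⊢
        intro j
        rw [← rightMul_mulClass hI]
        exact hRW _ _ (hsecond c hc d)) a
    simpa only [Submodule.mem_iInf, Submodule.mem_comap, LinearMap.flip_apply] using this
  obtain ⟨r, hr⟩ := derivedQuotient_induction hfirst v
  refine ⟨r.support.image Prod.fst ∪ r.support.image Prod.snd, fun i j => r (i, j), ?_⟩
  rw [← Finset.sum_product', ← hr]
  refine Finsupp.sum_of_support_subset _ (fun p hp => ?_) _ (fun p _ => by simp)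
  exact Finset.mem_product.2 ⟨Finset.mem_union_left _ (Finset.mem_image_of_mem _ hp),
    Finset.mem_union_right _ (Finset.mem_image_of_mem _ hp)⟩

end Metabelian

theorem FreeLeibniz.exists_linear_part (I : Submodule K (FreeLeibniz K ℕ)) (f : FreeLeibniz K ℕ) :
    ∃ c : ℕ →₀ K, I.mkQ (f - c.sum fun i t => t • of K i) ∈ derivedQuotient I := by
  have h := mem_of_mul_closed
    (Submodule.span K (Set.range (of K)) ⊔ (derivedQuotient I).comap I.mkQ)
    (fun i => Submodule.mem_sup_left (Submodule.subset_span ⟨i, rfl⟩))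
    (fun a b _ _ => Submodule.mem_sup_right (Submodule.subset_span ⟨a, b, rfl⟩)) f
  obtain ⟨y, hy, z, hz, rfl⟩ := Submodule.mem_sup.1 h
  obtain ⟨c, rfl⟩ := Finsupp.mem_span_range_iff_exists_finsupp.1 hy
  exact ⟨c, by rw [add_sub_cancel_left]; exact hz⟩

end DerivedQuotient

/-! ### Evaluating the module in `RR₂`. -/

section Evaluation

open MvPolynomial

variable {K : Type*} [Field K] {α : K} {I : Submodule K (FreeLeibniz K ℕ)}

/-- Evaluation in `RR₂`, on the quotient by an ideal of identities. -/
noncomputable def evalQuotient (hle : I ≤ identitiesOf K (RR2 K α)) (a : ℕ → RR2 K α) :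
    (FreeLeibniz K ℕ ⧸ I) →ₗ[K] RR2 K α :=
  I.liftQ
    { toFun := FreeLeibniz.lift K a
      map_add' := map_add _
      map_smul' := map_smul _ } (fun _ hf => hle hf a)

theorem evalQuotient_mkQ (hle : I ≤ identitiesOf K (RR2 K α)) (a : ℕ → RR2 K α)
    (f : FreeLeibniz K ℕ) : evalQuotient hle a (I.mkQ f) = FreeLeibniz.lift K a f := rfl

/-- The coordinates of `RR₂`, as linear forms. -/
def RR2.coord (α : K) (k : Fin 3) : RR2 K α →ₗ[K] K where
  toFun x := x k
  map_add' _ _ := rfl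
  map_smul' _ _ := rfl

theorem RR2.sum_apply {ι : Type*} (s : Finset ι) (f : ι → RR2 K α) (k : Fin 3) :
    (∑ i ∈ s, f i) k = ∑ i ∈ s, f i k :=
  map_sum (RR2.coord α k) f s

/-- The element of `RR₂` with given coordinates. -/
def RR2.ofCoords (α a b t : K) : RR2 K α := (![a, b, t] : Fin 3 → K)

theorem evalQuotient_apply_two (hle : I ≤ identitiesOf K (RR2 K α)) (a : ℕ → RR2 K α)
    (v : FreeLeibniz K ℕ ⧸ I) (hv : v ∈ derivedQuotient I) : evalQuotient hle a v 2 = 0 := by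
  have h : derivedQuotient I ≤ LinearMap.ker (RR2.coord α 2 ∘ₗ evalQuotient hle a) :=
    Submodule.span_le.2 (by
      rintro _ ⟨b, c, rfl⟩
      change FreeLeibniz.lift K a (b * c) 2 = 0
      rw [map_mul, RR2.mul_apply_two])
  exact h hv

theorem evalQuotient_rightMul (hI : IsTIdeal I) (hle : I ≤ identitiesOf K (RR2 K α))
    (a : ℕ → RR2 K α) (h : FreeLeibniz K ℕ) (v : derivedQuotient I) :
    evalQuotient hle a (rightMul hI h v) = evalQuotient hle a v * FreeLeibniz.lift K a h := by
  have := derivedQuotient_linearMap_ext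
    (f := evalQuotient hle a ∘ₗ (derivedQuotient I).subtype ∘ₗ rightMul hI h)
    (g := LinearMap.mulRight K (FreeLeibniz.lift K a h) ∘ₗ evalQuotient hle a ∘ₗ
      (derivedQuotient I).subtype)
    (fun b c => map_mul (FreeLeibniz.lift K a) (b * c) h)
  exact LinearMap.congr_fun this v

variable (hI : IsTIdeal I) (hle : I ≤ identitiesOf K (RR2 K α))
  (φ : MvPolynomial ℕ K →ₐ[K] Module.End K (derivedQuotient I))
  (hφ : ∀ i, φ (X i) = rightMul hI (FreeLeibniz.of K i))

include hφ in
theorem evalQuotient_action (a : ℕ → RR2 K α) (g : MvPolynomial ℕ K) (v : derivedQuotient I) :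
    evalQuotient hle a (φ g v) 0 = eval (fun i => α * a i 2) g * evalQuotient hle a v 0 ∧
    evalQuotient hle a (φ g v) 1 = eval (fun i => -a i 2) g * evalQuotient hle a v 1 := by
  induction g using MvPolynomial.induction_on generalizing v with
  | C t =>
    have h : φ (C t) v = t • v := by
      simp [← MvPolynomial.algebraMap_eq, Algebra.algebraMap_eq_smul_one]
    rw [h, Submodule.coe_smul, map_smul, RR2.smul_apply, RR2.smul_apply, eval_C, eval_C]
    exact ⟨rfl, rfl⟩
  | add p q hp hq =>
    rw [map_add, LinearMap.add_apply, Submodule.coe_add, map_add, RR2.add_apply, RR2.add_apply,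
      (hp v).1, (hp v).2, (hq v).1, (hq v).2, map_add, map_add, add_mul, add_mul]
    exact ⟨rfl, rfl⟩
  | mul_X p i hp =>
    rw [map_mul, Module.End.mul_apply, (hp _).1, (hp _).2, hφ, evalQuotient_rightMul,
      FreeLeibniz.lift_of, RR2.mul_apply_zero, RR2.mul_apply_one,
      evalQuotient_apply_two hle a v v.2, map_mul, map_mul, eval_X, eval_X]
    constructor <;> ring

include hφ in
theorem eval_coefficients_eq_zero (hα : α ≠ 0) (s : Finset ℕ) (r : ℕ → ℕ → MvPolynomial ℕ K)
    (h : ∀ a : ℕ → RR2 K α, evalQuotient hle a (∑ i ∈ s, ∑ j ∈ s,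
      φ (r i j) (mulClass I (FreeLeibniz.of K i) (FreeLeibniz.of K j)) : derivedQuotient I) = 0) :
    (∀ t : ℕ → K, ∀ i ∈ s, ∑ j ∈ s, eval t (r i j) * t j = 0) ∧
    (∀ t : ℕ → K, ∀ j ∈ s, ∑ i ∈ s, eval t (r i j) * t i = 0) := by
  have h0 : ∀ (a b t : ℕ → K),
      ∑ i ∈ s, ∑ j ∈ s, eval (fun i => α * t i) (r i j) * (α * (a i * t j)) = 0 ∧
      ∑ i ∈ s, ∑ j ∈ s, eval (fun i => -t i) (r i j) * (t i * b j - b i * t j) = 0 := by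
    intro a b t
    have hv := h (fun i => RR2.ofCoords α (a i) (b i) (t i))
    simp only [AddSubmonoidClass.coe_finsetSum, map_sum] at hv
    have hv0 := congrArg (RR2.coord α 0) hv
    have hv1 := congrArg (RR2.coord α 1) hv
    simp only [map_sum, map_zero] at hv0 hv1
    constructor
    · rw [← hv0]
      refine Finset.sum_congr rfl fun i _ => Finset.sum_congr rfl fun j _ => ?_
      refine Eq.trans ?_ (evalQuotient_action hI hle φ hφ _ _ _).1.symm
      rw [coe_mulClass, evalQuotient_mkQ, map_mul, FreeLeibniz.lift_of, FreeLeibniz.lift_of,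
        RR2.mul_apply_zero]
      rfl
    · rw [← hv1]
      refine Finset.sum_congr rfl fun i _ => Finset.sum_congr rfl fun j _ => ?_
      refine Eq.trans ?_ (evalQuotient_action hI hle φ hφ _ _ _).2.symm
      rw [coe_mulClass, evalQuotient_mkQ, map_mul, FreeLeibniz.lift_of, FreeLeibniz.lift_of,
        RR2.mul_apply_one]
      rfl
  have hrow : ∀ t : ℕ → K, ∀ i ∈ s, ∑ j ∈ s, eval t (r i j) * t j = 0 := by
    intro t i hi
    -- X_j acts on the e₁-coordinate by α times the e₃-coordinate; the factor α⁻¹ makes the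
    -- evaluation point exactly t.
    have h1 := (h0 (Pi.single i 1) 0 (fun j => α⁻¹ * t j)).1
    rw [Finset.sum_eq_single_of_mem i hi (fun k _ hk =>
      Finset.sum_eq_zero fun j _ => by rw [Pi.single_eq_of_ne hk]; ring)] at h1
    simpa only [Pi.single_eq_same, one_mul, mul_inv_cancel_left₀ hα] using h1
  refine ⟨hrow, fun t j hj => ?_⟩
  have h1 := (h0 0 (Pi.single j 1) (fun j => -t j)).2
  simp only [neg_neg, mul_sub, Finset.sum_sub_distrib] at h1
  -- The e₂-coordinate mixes rows and columns; its row part vanishes by the relation already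
  -- obtained.
  have h2 : ∑ i ∈ s, ∑ k ∈ s,
      eval (fun i => t i) (r i k) * (Pi.single (M := fun _ => K) j 1 i * -t k) = 0 :=
    Finset.sum_eq_zero fun i hi => by
      rw [← mul_zero (-Pi.single (M := fun _ => K) j 1 i), ← hrow t i hi, Finset.mul_sum]
      exact Finset.sum_congr rfl fun k _ => by ring
  rw [h2, sub_zero, Finset.sum_comm, Finset.sum_eq_single_of_mem j hj (fun k _ hk =>
      Finset.sum_eq_zero fun i _ => by rw [Pi.single_eq_of_ne hk]; ring)] at h1
  rw [← neg_eq_zero, ← h1, ← Finset.sum_neg_distrib]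
  exact Finset.sum_congr rfl fun i _ => by rw [Pi.single_eq_same]; ring

end Evaluation

/-! ### Consequences of the identities, and completeness. -/

section Main

open MvPolynomial

variable {K : Type*} [Field K] {α : K} {I : Submodule K (FreeLeibniz K ℕ)}

theorem identitiesOf_le_of_sum_action_eq_zero (hα : α ≠ 0) (hI : IsTIdeal I)
    (hle : I ≤ identitiesOf K (RR2 K α))
    (hmet : ∀ a b c d : FreeLeibniz K ℕ, (a * b) * (c * d) ∈ I)
    (hsum : ∀ φ : MvPolynomial ℕ K →ₐ[K] Module.End K (derivedQuotient I),
      (∀ i, φ (X i) = rightMul hI (FreeLeibniz.of K i)) →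
      ∀ (s : Finset ℕ) (r : ℕ → ℕ → MvPolynomial ℕ K),
      (∀ t : ℕ → K, ∀ i ∈ s, ∑ j ∈ s, eval t (r i j) * t j = 0) →
      (∀ t : ℕ → K, ∀ j ∈ s, ∑ i ∈ s, eval t (r i j) * t i = 0) →
      ∑ i ∈ s, ∑ j ∈ s,
        φ (r i j) (mulClass I (FreeLeibniz.of K i) (FreeLeibniz.of K j)) = 0) :
    identitiesOf K (RR2 K α) ≤ I := by
  classical
  intro f hf
  obtain ⟨c, hc⟩ := FreeLeibniz.exists_linear_part I f
  -- Products have zero e₃-coordinate, so sending x_i to e₃ and the other variables to 0 isolates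
  -- the coefficient of x_i.
  have hc0 : c = 0 := by
    ext i
    have h := evalQuotient_apply_two hle
      (fun k => RR2.ofCoords α 0 0 (Pi.single (M := fun _ => K) i 1 k)) _ hc
    rw [evalQuotient_mkQ, map_sub, hf, RR2.sub_apply, RR2.zero_apply, zero_sub, neg_eq_zero,
      Finsupp.sum, map_sum, RR2.sum_apply] at h
    simp only [map_smul, FreeLeibniz.lift_of, RR2.smul_apply] at h
    change ∑ k ∈ c.support, c k * Pi.single (M := fun _ => K) i 1 k = 0 at h
    rw [Finset.sum_eq_single i (fun k _ hk => by rw [Pi.single_eq_of_ne hk, mul_zero])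
      (fun hi => by rw [Finsupp.notMem_support_iff.1 hi, zero_mul]), Pi.single_eq_same,
      mul_one] at h
    exact h
  rw [hc0, Finsupp.sum_zero_index, sub_zero] at hc
  obtain ⟨φ, hφ⟩ := exists_action hI hmet
  obtain ⟨s, r, hv⟩ := exists_sum_action hI hmet φ hφ ⟨I.mkQ f, hc⟩
  have h := eval_coefficients_eq_zero hI hle φ hφ hα s r (fun a => by
    rw [← hv, evalQuotient_mkQ, hf])
  rw [hsum φ hφ s r h.1 h.2] at hv
  exact mkQ_eq_zero_iff.1 (congrArg Subtype.val hv)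

theorem cyclic_relation (hI : IsTIdeal I)
    (hs : ∀ a b c : FreeLeibniz K ℕ, standardThree a b c ∈ I) (a b c : FreeLeibniz K ℕ) :
    rightMul hI c (mulClass I a b) - rightMul hI b (mulClass I a c)
      - rightMul hI c (mulClass I b a) + rightMul hI a (mulClass I b c)
      + rightMul hI b (mulClass I c a) - rightMul hI a (mulClass I c b) = 0 :=
  Subtype.ext (by
    have h := mkQ_eq_zero_iff.2 (hs a b c)
    simp only [standardThree, map_add, map_sub] at h
    exact h)

/-- Substitute the product jl for the first variable of s₃. The terms with jl on the left cancel by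
commutativity, those acting by jl vanish, and the Leibniz rule expands the remaining two. -/
theorem exchange_relation (hI : IsTIdeal I)
    (hmet : ∀ a b c d : FreeLeibniz K ℕ, (a * b) * (c * d) ∈ I)
    (hs : ∀ a b c : FreeLeibniz K ℕ, standardThree a b c ∈ I) (i j k l : FreeLeibniz K ℕ) :
    rightMul hI k (rightMul hI l (mulClass I i j)) - rightMul hI k (rightMul hI j (mulClass I i l))
      = rightMul hI i (rightMul hI l (mulClass I k j))
        - rightMul hI i (rightMul hI j (mulClass I k l)) := by
  have h := cyclic_relation hI hs (j * l) i k
  have hc := LinearMap.congr_fun (rightMul_comm hI hmet i k) (mulClass I j l)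
  simp only [Module.End.mul_apply] at hc
  simp only [rightMul_mul hI hmet, LinearMap.zero_apply, ← rightMul_mulClass hI, mulClass_mul hI,
    map_sub, hc] at h
  rw [← sub_eq_zero, ← neg_eq_zero, ← h]
  abel

theorem identitiesOf_le_of_infinite [Infinite K] (hα : α ≠ 0) (hI : IsTIdeal I)
    (hle : I ≤ identitiesOf K (RR2 K α))
    (hmet : ∀ a b c d : FreeLeibniz K ℕ, (a * b) * (c * d) ∈ I)
    (hs : ∀ a b c : FreeLeibniz K ℕ, standardThree a b c ∈ I) :
    identitiesOf K (RR2 K α) ≤ I :=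
  identitiesOf_le_of_sum_action_eq_zero hα hI hle hmet fun φ hφ s r hrow hcol =>
    sum_action_eq_zero_of_infinite φ
      (fun i j => mulClass I (FreeLeibniz.of K i) (FreeLeibniz.of K j))
      (fun i j k l => by
        simp only [map_mul, hφ, Module.End.mul_apply]
        exact exchange_relation hI hmet hs _ _ _ _)
      (fun i j k => by
        simp only [hφ]
        exact cyclic_relation hI hs _ _ _) s r hrow hcol

theorem rightMul_pow_relation (hI : IsTIdeal I) {n : ℕ}
    (hpoly : ∀ a b : FreeLeibniz K ℕ, mulIter (mulIter a b (n + 2)) a (n + 1)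
      - mulIter (a * b) a (n + 1) - mulIter a b (n + 2) + a * b ∈ I) (a b : FreeLeibniz K ℕ) :
    (rightMul hI a ^ (n + 1)) ((rightMul hI b ^ (n + 1)) (mulClass I a b))
      - (rightMul hI a ^ (n + 1)) (mulClass I a b)
      - (rightMul hI b ^ (n + 1)) (mulClass I a b) + mulClass I a b = 0 := by
  have h1 : (rightMul hI b ^ (n + 1)) (mulClass I a b) = mulClass I (mulIter (a * b) b n) b :=
    Subtype.ext (by rw [coe_rightMul_pow_mulClass, mulIter_succ]; rfl)
  rw [h1]
  refine Subtype.ext ?_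
  have h := mkQ_eq_zero_iff.2 (hpoly a b)
  simp only [map_add, map_sub, mulIter_succ' a b, mulIter_succ (a * b) b] at h
  simp only [Submodule.coe_add, Submodule.coe_sub, coe_rightMul_pow_mulClass, coe_mulClass]
  exact h

/-- Linearize x^{q+1} = x² at a + bc, where q = n + 2. As bc acts by zero, this says that R_a^{q-1}
fixes a(bc) + (bc)a. The other identity with bc for its second variable says that it fixes a(bc),
hence also (bc)a = R_a(bc). -/
theorem rightMul_pow_eq_rightMul (hI : IsTIdeal I)
    (hmet : ∀ a b c d : FreeLeibniz K ℕ, (a * b) * (c * d) ∈ I) {n : ℕ}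
    (hpow : ∀ a : FreeLeibniz K ℕ, leftPow a (n + 3) - leftPow a 2 ∈ I)
    (hpoly : ∀ a b : FreeLeibniz K ℕ, mulIter (mulIter a b (n + 2)) a (n + 1)
      - mulIter (a * b) a (n + 1) - mulIter a b (n + 2) + a * b ∈ I) (a : FreeLeibniz K ℕ) :
    rightMul hI a ^ (n + 2) = rightMul hI a := by
  have hsq : ∀ a, (rightMul hI a ^ (n + 1)) (mulClass I a a) = mulClass I a a := fun a =>
    Subtype.ext (by
      rw [coe_rightMul_pow_mulClass]
      exact mkQ_eq_mkQ_iff.2 (hpow a))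
  refine derivedQuotient_linearMap_ext fun b c => ?_
  have hleft : (rightMul hI a ^ (n + 1)) (mulClass I a (b * c)) = mulClass I a (b * c) := by
    have h := rightMul_pow_relation hI hpoly a (b * c)
    rw [rightMul_mul hI hmet, zero_pow (Nat.succ_ne_zero n), LinearMap.zero_apply, map_zero,
      zero_sub, sub_zero, neg_add_eq_zero] at h
    exact h
  have h := hsq (a + b * c)
  have h0 : mulClass I (b * c) (b * c) = 0 := mulClass_eq_zero (hmet b c b c)
  simp only [map_add, rightMul_mul hI hmet, add_zero, LinearMap.add_apply, hsq a, hleft, h0] at h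
  rw [pow_succ, Module.End.mul_apply, rightMul_mulClass]
  simpa using h

theorem identitiesOf_le_of_finite [Fintype K] (hα : α ≠ 0) (hI : IsTIdeal I)
    (hle : I ≤ identitiesOf K (RR2 K α))
    (hmet : ∀ a b c d : FreeLeibniz K ℕ, (a * b) * (c * d) ∈ I)
    (hpow : ∀ a : FreeLeibniz K ℕ, leftPow a (Fintype.card K + 1) - leftPow a 2 ∈ I)
    (hpoly : ∀ a b : FreeLeibniz K ℕ,
      mulIter (mulIter a b (Fintype.card K)) a (Fintype.card K - 1)
      - mulIter (a * b) a (Fintype.card K - 1) - mulIter a b (Fintype.card K) + a * b ∈ I) :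
    identitiesOf K (RR2 K α) ≤ I := by
  -- With q = n + 2 the truncated subtraction in q - 1 disappears, and q - 1 is visibly positive.
  obtain ⟨n, hn⟩ := Nat.exists_eq_add_of_le' (Fintype.one_lt_card (α := K))
  rw [hn] at hpow hpoly
  refine identitiesOf_le_of_sum_action_eq_zero hα hI hle hmet fun φ hφ s r hrow hcol =>
    sum_action_eq_zero_of_finite φ (rightMul hI) (mulClass I) (FreeLeibniz.of K) hφ
      (fun y v => ?_) (fun y z => ?_) s r hrow hcol
  · rw [hn]
    exact LinearMap.congr_fun (rightMul_pow_eq_rightMul hI hmet hpow hpoly y) v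
  · rw [hn]
    exact rightMul_pow_relation hI hpoly y z

end Main

/-! ### The listed polynomials vanish on `RR₂`. -/

section Soundness

variable {K : Type*} [Field K] {α : K}

theorem RR2.mulIter_apply_zero (x y : RR2 K α) (n : ℕ) :
    mulIter x y n 0 = (α * y 2) ^ n * x 0 := by
  induction n with
  | zero => rw [mulIter_zero]; ring
  | succ n ih => rw [mulIter_succ, RR2.mul_apply_zero, ih]; ring

theorem RR2.mulIter_apply_one (x y : RR2 K α) (n : ℕ) :
    mulIter x y (n + 1) 1 = (-y 2) ^ n * (x 2 * y 1 - x 1 * y 2) := by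
  induction n with
  | zero => rw [mulIter_succ, mulIter_zero, RR2.mul_apply_one]; ring
  | succ n ih =>
    rw [mulIter_succ, RR2.mul_apply_one, ih, mulIter_succ, RR2.mul_apply_two]; ring

theorem RR2.mulIter_apply_two (x y : RR2 K α) (n : ℕ) : mulIter x y (n + 1) 2 = 0 := by
  rw [mulIter_succ, RR2.mul_apply_two]

theorem RR2.mul_mul_mul_eq_zero (x y z w : RR2 K α) : (x * y) * (z * w) = 0 := by
  apply RR2.ext <;>
    simp only [RR2.mul_apply_zero, RR2.mul_apply_one, RR2.mul_apply_two, RR2.zero_apply] <;> ring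

theorem RR2.standardThree_eq_zero (x y z : RR2 K α) : standardThree x y z = 0 := by
  apply RR2.ext <;>
    simp only [standardThree, RR2.add_apply, RR2.sub_apply, RR2.mul_apply_zero,
      RR2.mul_apply_one, RR2.mul_apply_two, RR2.zero_apply] <;> ring

section Finite

variable {n : ℕ} (hK : ∀ t : K, t ^ (n + 2) = t)
include hK

theorem RR2.leftPow_sub_leftPow_eq_zero (x : RR2 K α) :
    leftPow x (n + 2 + 1) - leftPow x 2 = 0 := by
  change mulIter x x (n + 1 + 1) - mulIter x x (0 + 1) = 0
  apply RR2.ext <;> simp only [RR2.sub_apply, RR2.mulIter_apply_zero, RR2.mulIter_apply_one,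
    RR2.mulIter_apply_two, RR2.zero_apply]
  · linear_combination x 0 * hK (α * x 2)
  · ring
  · ring

theorem RR2.exchange_identity (x y z : RR2 K α) :
    mulIter x y 2 * z - mulIter (mulIter z y 2 * x) z (n + 2 - 1)
      + mulIter (leftPow z (n + 2)) y 2 * x - mulIter (mulIter x z (n + 2)) y 2 = 0 := by
  change mulIter x y (1 + 1) * z - mulIter (mulIter z y (1 + 1) * x) z (n + 1)
      + mulIter (mulIter z z (n + 1)) y (1 + 1) * x - mulIter (mulIter x z (n + 1 + 1)) y (1 + 1)
      = 0
  apply RR2.ext <;> simp only [RR2.sub_apply, RR2.add_apply, RR2.mulIter_apply_zero,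
    RR2.mulIter_apply_one, RR2.mulIter_apply_two, RR2.mul_apply_zero, RR2.mul_apply_one,
    RR2.mul_apply_two, RR2.zero_apply]
  · linear_combination (-((α * y 2) ^ 2 * x 0)) * hK (α * z 2)
  -- Right multiplication scales the e₂-coordinate of a product by minus the e₃-coordinate. Naming
  -- that scalar t avoids signs depending on the parity of q.
  · obtain ⟨t, ht⟩ : ∃ t, z 2 = -t := ⟨-z 2, (neg_neg _).symm⟩
    simp only [ht, neg_neg]
    linear_combination (x 2 * y 2 * y 1 - y 2 ^ 2 * x 1) * hK t
  · ring

theorem RR2.product_identity (x y z : RR2 K α) :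
    mulIter (mulIter x y 2 * z) x (n + 2 - 1) - mulIter x y 2 * z
      - mulIter (mulIter (mulIter x z (n + 2)) y 2) x (n + 2 - 1)
      + mulIter (mulIter x z (n + 2)) y 2 = 0 := by
  change mulIter (mulIter x y (1 + 1) * z) x (n + 1) - mulIter x y (1 + 1) * z
      - mulIter (mulIter (mulIter x z (n + 1 + 1)) y (1 + 1)) x (n + 1)
      + mulIter (mulIter x z (n + 1 + 1)) y (1 + 1) = 0
  apply RR2.ext <;> simp only [RR2.sub_apply, RR2.add_apply, RR2.mulIter_apply_zero,
    RR2.mulIter_apply_one, RR2.mulIter_apply_two, RR2.mul_apply_zero, RR2.mul_apply_one,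
    RR2.mul_apply_two, RR2.zero_apply]
  · linear_combination
      (-((α * y 2) ^ 2 * x 0 * ((α * x 2) ^ (n + 1) - 1))) * hK (α * z 2)
  · obtain ⟨t, ht⟩ : ∃ t, z 2 = -t := ⟨-z 2, (neg_neg _).symm⟩
    obtain ⟨u, hu⟩ : ∃ u, x 2 = -u := ⟨-x 2, (neg_neg _).symm⟩
    simp only [ht, hu, neg_neg]
    linear_combination (-(u ^ (n + 1) - 1) * y 2 ^ 2 * x 1) * hK t
      + (t * y 2 * y 1 + y 2 ^ 2 * t ^ (n + 1) * z 1) * hK u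
  · ring

theorem RR2.power_identity (x y : RR2 K α) :
    mulIter (mulIter x y (n + 2)) x (n + 2 - 1) - mulIter (x * y) x (n + 2 - 1)
      - mulIter x y (n + 2) + x * y = 0 := by
  change mulIter (mulIter x y (n + 1 + 1)) x (n + 1) - mulIter (x * y) x (n + 1)
      - mulIter x y (n + 1 + 1) + x * y = 0
  apply RR2.ext <;> simp only [RR2.sub_apply, RR2.add_apply, RR2.mulIter_apply_zero,
    RR2.mulIter_apply_one, RR2.mulIter_apply_two, RR2.mul_apply_zero, RR2.mul_apply_one,
    RR2.mul_apply_two, RR2.zero_apply]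
  · linear_combination (((α * x 2) ^ (n + 1) - 1) * x 0) * hK (α * y 2)
  · obtain ⟨t, ht⟩ : ∃ t, y 2 = -t := ⟨-y 2, (neg_neg _).symm⟩
    obtain ⟨u, hu⟩ : ∃ u, x 2 = -u := ⟨-x 2, (neg_neg _).symm⟩
    simp only [ht, hu, neg_neg]
    linear_combination ((u ^ (n + 1) - 1) * x 1) * hK t - ((t ^ (n + 1) - 1) * y 1) * hK u
  · ring

end Finite

end Soundness

/-! ### Assembling the two bases. -/

theorem subset_tIdealSpan {K : Type*} [Field K] (S : Set (FreeLeibniz K ℕ)) :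
    S ⊆ tIdealSpan S := fun f hf => by
  rw [SetLike.mem_coe, tIdealSpan, Submodule.mem_sInf]
  exact fun I hI => hI.2 hf

/-- The bound I ≤ J is available because soundness comes first; it is what allows evaluation in
`RR₂` to descend to the quotient by `I`. -/
theorem isTBasis_of_le {K : Type*} [Field K] {S : Set (FreeLeibniz K ℕ)}
    {J : Submodule K (FreeLeibniz K ℕ)} (hJ : IsTIdeal J) (hS : S ⊆ J)
    (h : ∀ I : Submodule K (FreeLeibniz K ℕ), IsTIdeal I → S ⊆ I → I ≤ J → J ≤ I) :
    IsTBasis S J := by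
  have hle : tIdealSpan S ≤ J := sInf_le ⟨hJ, hS⟩
  exact le_antisymm hle (h _ (isTIdeal_tIdealSpan S) (subset_tIdealSpan S) hle)

/-- The substitution of `a, b, c, d` for the variables with indices `1, 2, 3, 4`. -/
noncomputable def substitution {K : Type*} [Field K] (a b c d : FreeLeibniz K ℕ) :
    FreeLeibniz K ℕ →ₙₐ[K] FreeLeibniz K ℕ :=
  FreeLeibniz.lift K fun n => if n = 1 then a else if n = 2 then b else if n = 3 then c else d

theorem substitution_of {K : Type*} [Field K] (a b c d : FreeLeibniz K ℕ) :
    substitution a b c d (FreeLeibniz.of K 1) = a ∧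
    substitution a b c d (FreeLeibniz.of K 2) = b ∧
    substitution a b c d (FreeLeibniz.of K 3) = c ∧
    substitution a b c d (FreeLeibniz.of K 4) = d := by
  simp [substitution]

theorem mainTheorem6 (K : Type*) [Field K] (α : K) (hα : α ≠ 0)
    (x : ℕ → FreeLeibniz K ℕ) (hx : x = FreeLeibniz.of K) :
    (∀ q : ℕ, Finite K → Nat.card K = q →
      IsTBasis
        {(x 1 * x 2) * (x 3 * x 4),
          standardThree (x 1) (x 2) (x 3),
          leftPow (x 1) (q + 1) - leftPow (x 1) 2,
          mulIter (x 1) (x 2) 2 * x 3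
            - mulIter (mulIter (x 3) (x 2) 2 * x 1) (x 3) (q - 1)
            + mulIter (leftPow (x 3) q) (x 2) 2 * x 1
            - mulIter (mulIter (x 1) (x 3) q) (x 2) 2,
          mulIter (mulIter (x 1) (x 2) 2 * x 3) (x 1) (q - 1)
            - mulIter (x 1) (x 2) 2 * x 3
            - mulIter (mulIter (mulIter (x 1) (x 3) q) (x 2) 2) (x 1) (q - 1)
            + mulIter (mulIter (x 1) (x 3) q) (x 2) 2,
          mulIter (mulIter (x 1) (x 2) q) (x 1) (q - 1)
            - mulIter (x 1 * x 2) (x 1) (q - 1)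
            - mulIter (x 1) (x 2) q
            + x 1 * x 2}
        (identitiesOf K (RR2 K α))) ∧
    (Infinite K →
      IsTBasis
        {(x 1 * x 2) * (x 3 * x 4),
          standardThree (x 1) (x 2) (x 3)}
        (identitiesOf K (RR2 K α))) := by 
  subst hx
  have hsub := @substitution_of K _
  constructor
  · intro q hfin hq
    have : Fintype K := Fintype.ofFinite K
    rw [Nat.card_eq_fintype_card] at hq
    obtain ⟨n, hn⟩ := Nat.exists_eq_add_of_le' (Fintype.one_lt_card (α := K))
    have hK : ∀ t : K, t ^ (n + 2) = t := fun t => by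
      have := FiniteField.pow_card t
      rwa [hn] at this
    refine isTBasis_of_le (isTIdeal_identitiesOf _) ?_ fun I hI hS hle => ?_
    · rw [← hq, hn]
      rintro f (rfl | rfl | rfl | rfl | rfl | rfl) a <;>
        simp only [map_sub, map_add, map_mul, map_mulIter, map_leftPow, map_standardThree]
      · exact RR2.mul_mul_mul_eq_zero _ _ _ _
      · exact RR2.standardThree_eq_zero _ _ _
      · exact RR2.leftPow_sub_leftPow_eq_zero hK _
      · exact RR2.exchange_identity hK _ _ _
      · exact RR2.product_identity hK _ _ _
      · exact RR2.power_identity hK _ _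
    · refine identitiesOf_le_of_finite hα hI hle (fun a b c d => ?_) (fun a => ?_) fun a b => ?_
      · have h := hI.map_mem (substitution a b c d) _ (hS (Or.inl rfl))
        simpa only [map_mul, hsub] using h
      · have h := hI.map_mem (substitution a a a a) _ (hS (Or.inr (Or.inr (Or.inl rfl))))
        simpa only [map_sub, map_leftPow, hsub, ← hq] using h
      · have h := hI.map_mem (substitution a b a a) _
          (hS (Or.inr (Or.inr (Or.inr (Or.inr (Or.inr rfl))))))
        simpa only [map_sub, map_add, map_mul, map_mulIter, hsub, ← hq] using h
  · intro hinf
    refine isTBasis_of_le (isTIdeal_identitiesOf _) ?_ fun I hI hS hle => ?_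
    · rintro f (rfl | rfl) a <;> simp only [map_mul, map_standardThree]
      · exact RR2.mul_mul_mul_eq_zero _ _ _ _
      · exact RR2.standardThree_eq_zero _ _ _
    · refine identitiesOf_le_of_infinite hα hI hle (fun a b c d => ?_) fun a b c => ?_
      · have h := hI.map_mem (substitution a b c d) _ (hS (Or.inl rfl))
        simpa only [map_mul, hsub] using h
      · have h := hI.map_mem (substitution a b c c) _ (hS (Or.inr rfl))
        simpa only [map_standardThree, hsub] using h
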